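/- Let $\Gamma$ be a finitely generated group with a finite generating set $\mathscr S$ such that $1\notin\mathscr S$ and $\mathscr S^{-1}=\mathscr S$, and let $L(\gamma)$ be the word length of $\gamma$ with respect to $\mathscr S$. Let $\ell^2(\Gamma)$ carry the left regular representation $(\gamma\cdot b)_\rho=b_{\gamma^{-1}\rho}$, and let $C^*_r(\Gamma)\subseteq\mathcal L(\ell^2(\Gamma))$ be the operator norm closure of the group algebra $\mathbb C[\Gamma]$. Suppose that $\Gamma$ has polynomial growth, that is, $\sum_{\gamma\in\Gamma}(1+L(\gamma))^{-s}<\infty$ for some $s>0$. Let $A$ be a unital $C^*$-algebra, faithfully (and unitally) represented on a Hilbert space $H$, and let $A\otimes C^*_r(\Gamma)$ be the spatial tensor product, i.e. the operator norm closure of the algebraic tensor product $A\odot C^*_r(\Gamma)$ in $\mathcal L(H\otimes\ell^2(\Gamma))$. Let $$H^\infty(\Gamma,A)=\Bigl\{(a_\gamma)_{\gamma\in\Gamma}\in A^\Gamma \;\Big|\; \sum_{\gamma\in\Gamma}\|a_\gamma\|^2L(\gamma)^s<\infty\ \text{for all real } s\ge 0\Bigr\},\qquad\text{where } 0^0=1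 .$$ Then for every $a\in H^\infty(\Gamma,A)$ the sum $\sum_\gamma a_\gamma\otimes\gamma$ converges unconditionally in norm in $A\otimes C^*_r(\Gamma)$. The resulting map $H^\infty(\Gamma,A)\to A\otimes C^*_r(\Gamma)$ is linear and injective, and its image is a unital subalgebra whose product corresponds to the convolution $(a\cdot b)_\gamma=\sum_{\rho}a_\rho b_{\rho^{-1}\gamma}$. Identified with this image, $H^\infty(\Gamma,A)$ 1. is dense in $A\otimes C^*_r(\Gamma)$; 2. is spectral: if $b\in H^\infty(\Gamma,A)$ is invertible in $A\otimes C^*_r(\Gamma)$, then $b^{-1}\in H^\infty(\Gamma,A)$; 3. is closed under holomorphic functional calculus: if $b\in H^\infty(\Gamma,A)$, $U\subseteq\mathbb C$ is an open neighbourhood of the spectrum of $b$ in $A\otimes C^*_r(\Gamma)$, and $f$ is holomorphic on $U$, then $f(b)=\frac1{2\pi i}\int_c f(z)(z-b)^{-1}\,dz$ belongs to $H^\infty(\Gamma,A)$. Here $c$ is any piecewise $C^1$ cycle in $U\setminus\operatorname{spec}(b)$ that has winding number $1$ about each point of $\operatorname{spec}(b)$ and winding number $0$ about each point outside $U$. 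-/

import Mathlib

open scoped TensorProduct ENNReal InnerProductSpace

noncomputable section

/-! ### The reduced group C*-algebra -/

/-- The Hilbert space `ℓ²(Γ)`. -/
abbrev EllTwo (Γ : Type*) : Type _ := lp (fun _ : Γ => ℂ) 2

theorem memℓp_comp_mulLeft {Γ : Type*} [Group Γ] (γ : Γ) (b : EllTwo Γ) :
    Memℓp (fun ρ => b (γ * ρ)) 2 := by
  have hb := lp.memℓp b
  rw [memℓp_gen_iff (by norm_num)] at hb ⊢
  exact (Equiv.mulLeft γ).summable_iff.mpr hb

/-- Left translation on `ℓ²(Γ)`: `(γ · b) ρ = b (γ⁻¹ ρ)`. -/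
def leftTranslation {Γ : Type*} [Group Γ] (γ : Γ) : EllTwo Γ →ₗᵢ[ℂ] EllTwo Γ where
  toFun b := ⟨fun ρ => b (γ⁻¹ * ρ), memℓp_comp_mulLeft γ⁻¹ b⟩
  map_add' b c := rfl
  map_smul' z b := rfl
  norm_map' b := by
    rw [lp.norm_eq_tsum_rpow (by norm_num), lp.norm_eq_tsum_rpow (by norm_num)]
    congr 1
    exact (Equiv.mulLeft γ⁻¹).tsum_eq (fun ρ => ‖b ρ‖ ^ (2 : ℝ≥0∞).toReal)

@[simp]
theorem leftTranslation_apply {Γ : Type*} [Group Γ] (γ : Γ) (b : EllTwo Γ) (ρ : Γ) :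
    leftTranslation γ b ρ = b (γ⁻¹ * ρ) := rfl

/-- The left regular representation of `Γ` on `ℓ²(Γ)`. -/
def leftRegularRep (Γ : Type*) [Group Γ] : Γ →* (EllTwo Γ →L[ℂ] EllTwo Γ) where
  toFun γ := (leftTranslation γ).toContinuousLinearMap
  map_one' := by ext b ρ; simp
  map_mul' γ σ := by ext b ρ; simp [mul_assoc]

@[simp]
theorem leftRegularRep_apply {Γ : Type*} [Group Γ] (γ : Γ) (b : EllTwo Γ) (ρ : Γ) :
    leftRegularRep Γ γ b ρ = b (γ⁻¹ * ρ) := rfl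

theorem star_leftRegularRep {Γ : Type*} [Group Γ] (γ : Γ) :
    star (leftRegularRep Γ γ) = leftRegularRep Γ γ⁻¹ := by
  rw [ContinuousLinearMap.star_eq_adjoint, eq_comm, ContinuousLinearMap.eq_adjoint_iff]
  intro b c
  rw [lp.inner_eq_tsum, lp.inner_eq_tsum, ← (Equiv.mulLeft γ⁻¹).tsum_eq]
  simp

/-- The action of the group algebra `ℂ[Γ]` on `ℓ²(Γ)`. -/
def groupAlgebraRep (Γ : Type*) [Group Γ] :
    MonoidAlgebra ℂ Γ →ₐ[ℂ] (EllTwo Γ →L[ℂ] EllTwo Γ) :=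
  MonoidAlgebra.lift ℂ _ Γ (leftRegularRep Γ)

theorem groupAlgebraRep_of {Γ : Type*} [Group Γ] (γ : Γ) :
    groupAlgebraRep Γ (MonoidAlgebra.of ℂ Γ γ) = leftRegularRep Γ γ := by
  simp [groupAlgebraRep]

/-- The image of `ℂ[Γ]` in the bounded operators on `ℓ²(Γ)`. -/
def groupAlgebraImage (Γ : Type*) [Group Γ] : StarSubalgebra ℂ (EllTwo Γ →L[ℂ] EllTwo Γ) where
  toSubalgebra := (groupAlgebraRep Γ).range
  star_mem' := by
    rintro _ ⟨x, rfl⟩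
    change star (groupAlgebraRep Γ x) ∈ (groupAlgebraRep Γ).range
    induction x using MonoidAlgebra.induction_on with
    | of γ =>
      rw [groupAlgebraRep_of, star_leftRegularRep, ← groupAlgebraRep_of]
      exact ⟨_, rfl⟩
    | add x y hx hy => rw [map_add, star_add]; exact add_mem hx hy
    | smul z x hx => rw [map_smul, star_smul]; exact Subalgebra.smul_mem _ hx _

/-- The reduced group C*-algebra `C*_r(Γ)`: the operator norm closure of `ℂ[Γ]` in the bounded
operators on `ℓ²(Γ)`. -/
def ReducedGroupCStar (Γ : Type*) [Group Γ] : StarSubalgebra ℂ (EllTwo Γ →L[ℂ] EllTwo Γ) :=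
  (groupAlgebraImage Γ).topologicalClosure

instance ReducedGroupCStar.instIsClosed (Γ : Type*) [Group Γ] :
    IsClosed (ReducedGroupCStar Γ : Set (EllTwo Γ →L[ℂ] EllTwo Γ)) :=
  StarSubalgebra.isClosed_topologicalClosure _

/-- The group element `γ`, as an element of `C*_r(Γ)`. -/
def ReducedGroupCStar.of {Γ : Type*} [Group Γ] (γ : Γ) : ReducedGroupCStar Γ :=
  ⟨leftRegularRep Γ γ, StarSubalgebra.le_topologicalClosure _
    ⟨MonoidAlgebra.of ℂ Γ γ, groupAlgebraRep_of γ⟩⟩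

/-! ### The spatial tensor product -/

/-- The Hilbert space tensor product: the completion of the algebraic tensor product. -/
def HilbertTensor (H K : Type*) [NormedAddCommGroup H] [InnerProductSpace ℂ H]
    [NormedAddCommGroup K] [InnerProductSpace ℂ K] : Type _ :=
  UniformSpace.Completion (H ⊗[ℂ] K)

section Operators

variable {H K : Type*} [NormedAddCommGroup H] [InnerProductSpace ℂ H]
  [NormedAddCommGroup K] [InnerProductSpace ℂ K]

instance HilbertTensor.instNormedAddCommGroup : NormedAddCommGroup (HilbertTensor H K) :=
  inferInstanceAs (NormedAddCommGroup (UniformSpace.Completion (H ⊗[ℂ] K)))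

instance HilbertTensor.instInnerProductSpace : InnerProductSpace ℂ (HilbertTensor H K) :=
  inferInstanceAs (InnerProductSpace ℂ (UniformSpace.Completion (H ⊗[ℂ] K)))

instance HilbertTensor.instCompleteSpace : CompleteSpace (HilbertTensor H K) :=
  inferInstanceAs (CompleteSpace (UniformSpace.Completion (H ⊗[ℂ] K)))

/-- The inclusion of the algebraic tensor product in the Hilbert space tensor product. -/
def HilbertTensor.mk : H ⊗[ℂ] K →ₗᵢ[ℂ] HilbertTensor H K :=
  UniformSpace.Completion.toComplₗᵢ (𝕜 := ℂ) (E := H ⊗[ℂ] K)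

theorem HilbertTensor.denseRange_mk :
    DenseRange (HilbertTensor.mk : H ⊗[ℂ] K →ₗᵢ[ℂ] HilbertTensor H K) :=
  UniformSpace.Completion.denseRange_coe

/-- The operator `S ⊗ T` on the Hilbert space tensor product: the continuous extension of the
algebraic tensor product of `S` and `T`. -/
def opTensor (S : H →L[ℂ] H) (T : K →L[ℂ] K) : HilbertTensor H K →L[ℂ] HilbertTensor H K :=
  (HilbertTensor.mk.toContinuousLinearMap ∘L TensorProduct.mapL S T).extend
    HilbertTensor.mk.toContinuousLinearMap

@[simp]
theorem opTensor_mk (S : H →L[ℂ] H) (T : K →L[ℂ] K) (x : H ⊗[ℂ] K) :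
    opTensor S T (HilbertTensor.mk x) = HilbertTensor.mk (TensorProduct.mapL S T x) := by
  have hd : DenseRange (HilbertTensor.mk (H := H) (K := K)).toContinuousLinearMap :=
    HilbertTensor.denseRange_mk
  have hu : IsUniformInducing (HilbertTensor.mk (H := H) (K := K)).toContinuousLinearMap :=
    (HilbertTensor.mk (H := H) (K := K)).isometry.isUniformInducing
  exact ContinuousLinearMap.extend_eq
    (HilbertTensor.mk.toContinuousLinearMap ∘L TensorProduct.mapL S T) hd hu x

theorem ext_hilbertTensor {E : Type*} [NormedAddCommGroup E] [NormedSpace ℂ E]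
    {S T : HilbertTensor H K →L[ℂ] E}
    (h : ∀ (x : H) (y : K), S (HilbertTensor.mk (x ⊗ₜ[ℂ] y)) =
      T (HilbertTensor.mk (x ⊗ₜ[ℂ] y))) : S = T := by
  ext v
  induction v using HilbertTensor.denseRange_mk.induction_on with
  | hp => exact isClosed_eq S.continuous T.continuous
  | ih x =>
    induction x using TensorProduct.induction_on with
    | zero => simp
    | tmul x y => exact h x y
    | add x y hx hy => rw [map_add, map_add, map_add, hx, hy]

theorem opTensor_mul (S S' : H →L[ℂ] H) (T T' : K →L[ℂ] K) :
    opTensor S T * opTensor S' T' = opTensor (S * S') (T * T') :=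
  ext_hilbertTensor fun x y => by simp

theorem star_opTensor [CompleteSpace H] [CompleteSpace K] (S : H →L[ℂ] H) (T : K →L[ℂ] K) :
    star (opTensor S T) = opTensor (star S) (star T) := by
  rw [ContinuousLinearMap.star_eq_adjoint, eq_comm, ContinuousLinearMap.eq_adjoint_iff]
  intro u v
  induction u, v using HilbertTensor.denseRange_mk.induction_on₂ with
  | hp => apply isClosed_eq <;> fun_prop
  | h u v =>
    rw [opTensor_mk, opTensor_mk, LinearIsometry.inner_map_map, LinearIsometry.inner_map_map]
    induction u using TensorProduct.induction_on with
    | zero => simp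
    | add u u' hu hu' => rw [map_add, inner_add_left, inner_add_left, hu, hu']
    | tmul x y =>
      induction v using TensorProduct.induction_on with
      | zero => simp
      | add v v' hv hv' => rw [map_add, inner_add_right, inner_add_right, hv, hv']
      | tmul x' y' =>
        simp [ContinuousLinearMap.star_eq_adjoint, ContinuousLinearMap.adjoint_inner_left]

/-- `S ↦ S ⊗ 1`. -/
def opTensorLeft (H K : Type*) [NormedAddCommGroup H] [InnerProductSpace ℂ H]
    [NormedAddCommGroup K] [InnerProductSpace ℂ K] :
    (H →L[ℂ] H) →ₐ[ℂ] (HilbertTensor H K →L[ℂ] HilbertTensor H K) :=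
  AlgHom.ofLinearMap
    { toFun := fun S => opTensor S 1
      map_add' := fun S S' => ext_hilbertTensor fun x y => by
        simp [TensorProduct.add_tmul]
      map_smul' := fun z S => ext_hilbertTensor fun x y => by
        simp [← TensorProduct.smul_tmul'] }
    (ext_hilbertTensor fun x y => by simp)
    (fun S S' => by simp [opTensor_mul])

/-- `T ↦ 1 ⊗ T`. -/
def opTensorRight (H K : Type*) [NormedAddCommGroup H] [InnerProductSpace ℂ H]
    [NormedAddCommGroup K] [InnerProductSpace ℂ K] :
    (K →L[ℂ] K) →ₐ[ℂ] (HilbertTensor H K →L[ℂ] HilbertTensor H K) :=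
  AlgHom.ofLinearMap
    { toFun := fun T => opTensor 1 T
      map_add' := fun T T' => ext_hilbertTensor fun x y => by
        simp [TensorProduct.tmul_add]
      map_smul' := fun z T => ext_hilbertTensor fun x y => by
        simp [TensorProduct.tmul_smul] }
    (ext_hilbertTensor fun x y => by simp)
    (fun T T' => by simp [opTensor_mul])

end Operators

section SpatialTensor

variable {A H : Type*} [CStarAlgebra A] [NormedAddCommGroup H] [InnerProductSpace ℂ H]
  [CompleteSpace H]

/-- The action of the algebraic tensor product `A ⊗ C*_r(Γ)` on `H ⊗ ℓ²(Γ)` that belongs to a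
representation `π` of `A` on `H`; it sends `a ⊗ c` to `π a ⊗ c`. -/
def algTensorRep (π : A →⋆ₐ[ℂ] (H →L[ℂ] H)) (Γ : Type*) [Group Γ] :
    A ⊗[ℂ] ReducedGroupCStar Γ →ₐ[ℂ]
      (HilbertTensor H (EllTwo Γ) →L[ℂ] HilbertTensor H (EllTwo Γ)) :=
  Algebra.TensorProduct.lift ((opTensorLeft H (EllTwo Γ)).comp π.toAlgHom)
    ((opTensorRight H (EllTwo Γ)).comp (ReducedGroupCStar Γ).subtype.toAlgHom)
    (fun a c => by
      change opTensor (π a) 1 * opTensor 1 (c : EllTwo Γ →L[ℂ] EllTwo Γ) =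
        opTensor 1 (c : EllTwo Γ →L[ℂ] EllTwo Γ) * opTensor (π a) 1
      simp [opTensor_mul])

theorem algTensorRep_tmul (π : A →⋆ₐ[ℂ] (H →L[ℂ] H)) {Γ : Type*} [Group Γ] (a : A)
    (c : ReducedGroupCStar Γ) :
    algTensorRep π Γ (a ⊗ₜ[ℂ] c) = opTensor (π a) (c : EllTwo Γ →L[ℂ] EllTwo Γ) := by
  rw [algTensorRep, Algebra.TensorProduct.lift_tmul]
  change opTensor (π a) 1 * opTensor 1 (c : EllTwo Γ →L[ℂ] EllTwo Γ) = _
  simp [opTensor_mul]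

/-- The image of the algebraic tensor product in the bounded operators on `H ⊗ ℓ²(Γ)`. -/
def algTensorImage (π : A →⋆ₐ[ℂ] (H →L[ℂ] H)) (Γ : Type*) [Group Γ] :
    StarSubalgebra ℂ (HilbertTensor H (EllTwo Γ) →L[ℂ] HilbertTensor H (EllTwo Γ)) where
  toSubalgebra := (algTensorRep π Γ).range
  star_mem' := by
    rintro _ ⟨x, rfl⟩
    change star (algTensorRep π Γ x) ∈ (algTensorRep π Γ).range
    induction x using TensorProduct.induction_on with
    | zero => rw [map_zero, star_zero]; exact zero_mem _
    | add x y hx hy => rw [map_add, star_add]; exact add_mem hx hy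
    | tmul a c =>
      refine ⟨star a ⊗ₜ star c, ?_⟩
      change algTensorRep π Γ (star a ⊗ₜ star c) = _
      rw [algTensorRep_tmul, algTensorRep_tmul, star_opTensor, map_star]
      rfl

/-- The spatial C*-tensor product `A ⊗ C*_r(Γ)`, where `A` is represented on `H` through `π`: the
operator norm closure of the algebraic tensor product in the bounded operators on `H ⊗ ℓ²(Γ)`. -/
def SpatialTensor (π : A →⋆ₐ[ℂ] (H →L[ℂ] H)) (Γ : Type*) [Group Γ] :
    StarSubalgebra ℂ (HilbertTensor H (EllTwo Γ) →L[ℂ] HilbertTensor H (EllTwo Γ)) :=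
  (algTensorImage π Γ).topologicalClosure

instance SpatialTensor.instIsClosed (π : A →⋆ₐ[ℂ] (H →L[ℂ] H)) (Γ : Type*) [Group Γ] :
    IsClosed (SpatialTensor π Γ :
      Set (HilbertTensor H (EllTwo Γ) →L[ℂ] HilbertTensor H (EllTwo Γ))) :=
  StarSubalgebra.isClosed_topologicalClosure _

/-- The elementary tensor `a ⊗ c` in `A ⊗ C*_r(Γ)`. -/
def SpatialTensor.tmul (π : A →⋆ₐ[ℂ] (H →L[ℂ] H)) {Γ : Type*} [Group Γ] (a : A)
    (c : ReducedGroupCStar Γ) : SpatialTensor π Γ :=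
  ⟨algTensorRep π Γ (a ⊗ₜ[ℂ] c), StarSubalgebra.le_topologicalClosure _ ⟨a ⊗ₜ[ℂ] c, rfl⟩⟩

end SpatialTensor

/-! ### Word length, polynomial growth, rapidly decreasing sequences -/

/-- The word length of `γ` with respect to `S`: the least `n` such that `γ` is a product of `n`
elements of `S`. -/
def wordLength {Γ : Type*} [Group Γ] (S : Finset Γ) (γ : Γ) : ℕ :=
  sInf {n | ∃ l : List Γ, l.length = n ∧ (∀ x ∈ l, x ∈ S) ∧ l.prod = γ}

/-- Polynomial growth: `∑ γ, (1 + L(γ))⁻ˢ < ∞` for some `s > 0`. -/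
def HasPolynomialGrowth {Γ : Type*} [Group Γ] (S : Finset Γ) : Prop :=
  ∃ s : ℝ, 0 < s ∧ Summable fun γ : Γ => (1 + (wordLength S γ : ℝ)) ^ (-s)

/-- The space `H^∞(Γ, A)` of rapidly decreasing `A`-valued sequences. (Here `0 ^ 0 = 1`, so that
the condition for `s = 0` is square-summability.) -/
def HInfty {Γ : Type*} [Group Γ] (S : Finset Γ) (A : Type*) [NormedAddCommGroup A]
    [NormedSpace ℂ A] : Submodule ℂ (Γ → A) where
  carrier := {a | ∀ s : ℝ, 0 ≤ s → Summable fun γ : Γ => ‖a γ‖ ^ 2 * (wordLength S γ : ℝ) ^ s}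
  zero_mem' s _ := by simp
  add_mem' {a b} ha hb s hs := by
    refine Summable.of_nonneg_of_le (fun γ => by positivity) (fun γ => ?_)
      (((ha s hs).add (hb s hs)).mul_left 2)
    have h0 : (0 : ℝ) ≤ (wordLength S γ : ℝ) ^ s := by positivity
    have h1 : ‖a γ + b γ‖ ^ 2 ≤ 2 * (‖a γ‖ ^ 2 + ‖b γ‖ ^ 2) := by
      nlinarith [norm_add_le (a γ) (b γ), norm_nonneg (a γ + b γ), norm_nonneg (a γ),
        norm_nonneg (b γ), sq_nonneg (‖a γ‖ - ‖b γ‖)]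
    calc ‖(a + b) γ‖ ^ 2 * (wordLength S γ : ℝ) ^ s
        ≤ 2 * (‖a γ‖ ^ 2 + ‖b γ‖ ^ 2) * (wordLength S γ : ℝ) ^ s :=
          mul_le_mul_of_nonneg_right h1 h0
      _ = _ := by ring
  smul_mem' z a ha s hs := by
    refine ((ha s hs).mul_left (‖z‖ ^ 2)).congr fun γ => ?_
    rw [Pi.smul_apply, norm_smul]
    ring

/-! ### Spectral subalgebras and the holomorphic functional calculus -/

/-- A subalgebra `T` of a C*-algebra `B` is spectral if the inverse in `B` of an element of `T`
belongs to `T` whenever it exists. -/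
def IsSpectralSubalgebra {B : Type*} [CStarAlgebra B] (T : Subalgebra ℂ B) : Prop :=
  ∀ u : Bˣ, (u : B) ∈ T → ((u⁻¹ : Bˣ) : B) ∈ T

/-- A `C¹` cycle in the plane: a finite formal integer combination of `C¹` paths on `[0, 1]` whose
boundary vanishes. Closed piecewise `C¹` curves are of this kind, as are their combinations. -/
structure PlaneCycle where
  n : ℕ
  mult : Fin n → ℤ
  path : Fin n → ℝ → ℂ
  contDiffOn : ∀ i, ContDiffOn ℝ 1 (path i) (Set.Icc 0 1)
  boundary : ∑ i, mult i • (Finsupp.single (path i 1) (1 : ℤ) - Finsupp.single (path i 0) 1) = 0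

namespace PlaneCycle

/-- The points on the paths of the cycle. -/
def trace (c : PlaneCycle) : Set ℂ := ⋃ i, c.path i '' Set.Icc 0 1

/-- The contour integral `∫_c F(z) dz`. -/
def integral {E : Type*} [NormedAddCommGroup E] [NormedSpace ℂ E] (c : PlaneCycle) (F : ℂ → E) :
    E :=
  ∑ i, c.mult i • ∫ t in (0 : ℝ)..1, deriv (c.path i) t • F (c.path i t)

/-- The winding number of the cycle about `w` (for `w` not on the cycle). -/
def winding (c : PlaneCycle) (w : ℂ) : ℂ :=
  (2 * Real.pi * Complex.I)⁻¹ * c.integral fun z => (z - w)⁻¹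

/-- The cycle lies in `U \ K` and winds once about every point of `K` and not at all about the
points outside `U`. -/
def Surrounds (c : PlaneCycle) (K U : Set ℂ) : Prop :=
  c.trace ⊆ U \ K ∧ (∀ w ∈ K, c.winding w = 1) ∧ ∀ w ∉ U, c.winding w = 0

end PlaneCycle

/-- `x = f(b)` in the holomorphic functional calculus: `x` is the Cauchy integral
`(2πi)⁻¹ ∫_c f(z) (z - b)⁻¹ dz` over a cycle `c` that surrounds the spectrum of `b` in the open
set `U` on which `f` is holomorphic. -/
def IsHolomorphicCalculusValue {B : Type*} [CStarAlgebra B] (f : ℂ → ℂ) (U : Set ℂ) (b x : B) :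
    Prop :=
  IsOpen U ∧ spectrum ℂ b ⊆ U ∧ DifferentiableOn ℂ f U ∧
    ∃ c : PlaneCycle, c.Surrounds (spectrum ℂ b) U ∧
      x = (2 * Real.pi * Complex.I : ℂ)⁻¹ • c.integral fun z => f z • resolvent b z

/-- `f(b) ∈ T` for every `b ∈ T` and every `f` holomorphic on an open neighbourhood of the
spectrum of `b` in `B`. -/
def IsClosedUnderHolomorphicCalculus {B : Type*} [CStarAlgebra B] (T : Subalgebra ℂ B) : Prop :=
  ∀ b ∈ T, ∀ (f : ℂ → ℂ) (U : Set ℂ) (x : B), IsHolomorphicCalculusValue f U b x → x ∈ T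

end

/-!
A rapidly decreasing sequence `a` is absolutely summable, by polynomial growth and the inequality
between the arithmetic and the geometric mean, so `∑ a_γ ⊗ γ` converges in norm. Its coefficients
are matrix entries of the operator `∑ a_γ ⊗ γ` on `H ⊗ ℓ²(Γ)`, and an element of the spatial tensor
product is determined by its coefficients, since it commutes with the right translations.

The image of `H^∞(Γ, A)` consists of the elements that are smooth for the derivation `[1 ⊗ L, ·]`,
where `L` acts on `ℓ²(Γ)` by multiplication. To work with bounded operators only, `L` is replaced by
its truncations `min L n`, and an element is called smooth if all its iterated commutators with them
are bounded uniformly in `n` (`smoothSubalgebra`). The two descriptions agree: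

* the truncations are `1`-Lipschitz for the word metric, so a `k`-fold commutator of `a_γ ⊗ γ` has
  norm at most `‖a_γ‖ L(γ)ᵏ` (`norm_innerDerivation_pow_tmul_of_le`), which is summable for a
  rapidly decreasing sequence (`HInfty.summable_norm_mul_pow`);
* since `L(1) = 0`, the coefficient at `γ` of a `k`-fold commutator of `b` is `L(γ)ᵏ` times that of
  `b` for large `n`, so the coefficients of a smooth element satisfy `sup ‖b_γ‖ L(γ)ᵏ < ∞` for all
  `k` (`bounded_matrixEntry_of_mem_smoothSubalgebra`); by polynomial growth they are square summable
  against all powers of `L` (`mem_HInfty_of_bounded`). They lie in `π A` because `π A` is closed.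

Smooth elements are closed under products and inverses by the rules `δ(xy) = δ(x)y + xδ(y)` and
`δ(x⁻¹) = -x⁻¹δ(x)x⁻¹` (`BoundedUpTo.mul`, `BoundedUpTo.inverse`). The rule for inverses applies to
families as well: the commutators of the resolvents `(z - b)⁻¹` are bounded uniformly for `z` on a
compact curve in the resolvent set, so a Cauchy integral over such a curve is smooth.
-/

/-! ### Families that are bounded under iterated commutators -/

section Commutators

variable {R : Type*} [NormedRing R] [NormedAlgebra ℂ R] {I : Type*}

/-- The inner derivation `x ↦ D x - x D`, as a bounded operator. -/
noncomputable def innerDerivation (D : R) : R →L[ℂ] R :=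
  ContinuousLinearMap.mul ℂ R D - (ContinuousLinearMap.mul ℂ R).flip D

theorem innerDerivation_apply (D x : R) : innerDerivation D x = D * x - x * D := rfl

theorem innerDerivation_pow_succ (D x : R) (k : ℕ) :
    (innerDerivation D ^ (k + 1)) x = (innerDerivation D ^ k) (innerDerivation D x) := by
  rw [pow_succ]; rfl

theorem innerDerivation_pow_succ' (D x : R) (k : ℕ) :
    (innerDerivation D ^ (k + 1)) x = innerDerivation D ((innerDerivation D ^ k) x) := by
  rw [pow_succ']; rfl

/-- The family `X` is bounded, and remains so after up to `k` commutators with the family `D`. -/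
noncomputable def BoundedUpTo (D X : I → R) (k : ℕ) : Prop :=
  ∀ j ≤ k, ∃ C : ℝ, ∀ i, ‖(innerDerivation (D i) ^ j) (X i)‖ ≤ C

namespace BoundedUpTo

variable {D X Y : I → R} {k : ℕ}

theorem mono {l : ℕ} (hX : BoundedUpTo D X l) (hk : k ≤ l) : BoundedUpTo D X k :=
  fun j hj => hX j (hj.trans hk)

theorem zero_iff : BoundedUpTo D X 0 ↔ ∃ C : ℝ, ∀ i, ‖X i‖ ≤ C := by
  simp [BoundedUpTo]

theorem succ_iff : BoundedUpTo D X (k + 1) ↔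
    (∃ C : ℝ, ∀ i, ‖X i‖ ≤ C) ∧ BoundedUpTo D (fun i => innerDerivation (D i) (X i)) k := by
  constructor
  · intro h
    refine ⟨zero_iff.1 (h.mono (Nat.zero_le _)), fun j hj => ?_⟩
    simpa only [innerDerivation_pow_succ] using h (j + 1) (by lia)
  · rintro ⟨h0, h⟩ j hj
    cases j with
    | zero => simpa using h0
    | succ j => simpa only [innerDerivation_pow_succ] using h j (by lia)

theorem bounded (hX : BoundedUpTo D X k) : ∃ C : ℝ, ∀ i, ‖X i‖ ≤ C :=
  zero_iff.1 (hX.mono (Nat.zero_le _))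

theorem add (hX : BoundedUpTo D X k) (hY : BoundedUpTo D Y k) :
    BoundedUpTo D (fun i => X i + Y i) k := fun j hj => by
  obtain ⟨C, hC⟩ := hX j hj
  obtain ⟨C', hC'⟩ := hY j hj
  refine ⟨C + C', fun i => ?_⟩
  rw [map_add]
  exact norm_add_le_of_le (hC i) (hC' i)

theorem neg (hX : BoundedUpTo D X k) : BoundedUpTo D (fun i => -X i) k := fun j hj => by
  simpa only [map_neg, norm_neg] using hX j hj

theorem smul {c : I → ℂ} {M : ℝ} (hc : ∀ i, ‖c i‖ ≤ M) (hX : BoundedUpTo D X k) :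
    BoundedUpTo D (fun i => c i • X i) k := fun j hj => by
  obtain ⟨C, hC⟩ := hX j hj
  refine ⟨M * C, fun i => ?_⟩
  rw [map_smul, norm_smul]
  exact mul_le_mul (hc i) (hC i) (norm_nonneg _) ((norm_nonneg _).trans (hc i))

theorem one : BoundedUpTo D (fun _ => 1) k := by
  intro j _
  cases j with
  | zero => exact ⟨‖(1 : R)‖, fun i => by simp⟩
  | succ j => exact ⟨0, fun i => by rw [innerDerivation_pow_succ, innerDerivation_apply]; simp⟩

/-- The Leibniz rule `δ(XY) = δ(X)Y + Xδ(Y)` reduces order `k + 1` to order `k`. -/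
theorem mul (hX : BoundedUpTo D X k) (hY : BoundedUpTo D Y k) :
    BoundedUpTo D (fun i => X i * Y i) k := by
  have hb : ∀ {X Y : I → R}, (∃ C : ℝ, ∀ i, ‖X i‖ ≤ C) → (∃ C : ℝ, ∀ i, ‖Y i‖ ≤ C) →
      ∃ C : ℝ, ∀ i, ‖X i * Y i‖ ≤ C := by
    rintro X Y ⟨C, hC⟩ ⟨C', hC'⟩
    exact ⟨C * C', fun i => norm_mul_le_of_le (hC i) (hC' i)⟩
  induction k generalizing X Y with
  | zero => exact zero_iff.2 (hb hX.bounded hY.bounded)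
  | succ k ih =>
    refine succ_iff.2 ⟨hb hX.bounded hY.bounded, ?_⟩
    have h := (ih (succ_iff.1 hX).2 (hY.mono k.le_succ)).add
      (ih (hX.mono k.le_succ) (succ_iff.1 hY).2)
    convert h using 2 with i
    simp only [innerDerivation_apply]
    noncomm_ring

/-- The rule `δ(X⁻¹) = -X⁻¹δ(X)X⁻¹` reduces order `k + 1` to order `k`. -/
theorem inverse (hX : BoundedUpTo D X k) (hXY : ∀ i, X i * Y i = 1) (hYX : ∀ i, Y i * X i = 1)
    (hY : ∃ C : ℝ, ∀ i, ‖Y i‖ ≤ C) : BoundedUpTo D Y k := by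
  induction k with
  | zero => exact zero_iff.2 hY
  | succ k ih =>
    have hYk := ih (hX.mono k.le_succ)
    refine succ_iff.2 ⟨hY, ?_⟩
    convert ((hYk.mul (succ_iff.1 hX).2).mul hYk).neg using 2 with i
    simp only [innerDerivation_apply]
    calc D i * Y i - Y i * D i = (Y i * X i) * D i * Y i - Y i * D i * (X i * Y i) := by
          rw [hXY, hYX]; simp
      _ = -(Y i * (D i * X i - X i * D i) * Y i) := by noncomm_ring

end BoundedUpTo

end Commutators

/-! ### Matrix entries of operators on `H ⊗ ℓ²(Γ)` -/

section OpTensorNorm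

variable {H K : Type*} [NormedAddCommGroup H] [InnerProductSpace ℂ H]
  [NormedAddCommGroup K] [InnerProductSpace ℂ K]

theorem norm_opTensor_le (P : H →L[ℂ] H) (Q : K →L[ℂ] K) : ‖opTensor P Q‖ ≤ ‖P‖ * ‖Q‖ := by
  refine ContinuousLinearMap.opNorm_le_bound _ (by positivity) fun v => ?_
  induction v using HilbertTensor.denseRange_mk.induction_on with
  | hp => apply isClosed_le <;> fun_prop
  | ih x =>
    rw [opTensor_mk, LinearIsometry.norm_map, LinearIsometry.norm_map]
    exact (TensorProduct.mapL P Q).le_of_opNorm_le (TensorProduct.norm_mapL_le P Q) x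

theorem opTensor_sub_right (P : H →L[ℂ] H) (Q Q' : K →L[ℂ] K) :
    opTensor P (Q - Q') = opTensor P Q - opTensor P Q' :=
  ext_hilbertTensor fun x y => by simp [TensorProduct.tmul_sub]

theorem continuous_opTensor_right (P : H →L[ℂ] H) :
    Continuous fun Q : K →L[ℂ] K => opTensor P Q := by
  refine (LipschitzWith.of_dist_le_mul (K := ‖P‖₊) fun Q Q' => ?_).continuous
  rw [dist_eq_norm, dist_eq_norm, ← opTensor_sub_right]
  exact norm_opTensor_le P (Q - Q')

theorem opTensor_smul_right (z : ℂ) (P : H →L[ℂ] H) (Q : K →L[ℂ] K) :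
    opTensor P (z • Q) = opTensor (z • P) Q :=
  ext_hilbertTensor fun x y => by simp [TensorProduct.smul_tmul]

theorem opTensor_add_right (P : H →L[ℂ] H) (Q Q' : K →L[ℂ] K) :
    opTensor P (Q + Q') = opTensor P Q + opTensor P Q' :=
  ext_hilbertTensor fun x y => by simp [TensorProduct.tmul_add]

end OpTensorNorm

theorem norm_leftRegularRep_le {Γ : Type*} [Group Γ] (γ : Γ) : ‖leftRegularRep Γ γ‖ ≤ 1 :=
  (leftTranslation γ).norm_toContinuousLinearMap_le

/-- The bounded operators on `H ⊗ ℓ²(Γ)`. -/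
abbrev TensorOp (H Γ : Type*) [NormedAddCommGroup H] [InnerProductSpace ℂ H] : Type _ :=
  HilbertTensor H (EllTwo Γ) →L[ℂ] HilbertTensor H (EllTwo Γ)

section Slices

variable (H : Type*) {Γ : Type*} [NormedAddCommGroup H] [InnerProductSpace ℂ H]

open Classical in
/-- The isometry `x ↦ x ⊗ δ_σ` of `H` into `H ⊗ ℓ²(Γ)`. -/
noncomputable def sliceIn (σ : Γ) : H →L[ℂ] HilbertTensor H (EllTwo Γ) :=
  HilbertTensor.mk.toContinuousLinearMap ∘L
    (TensorProduct.mkL ℂ H (EllTwo Γ)).flip (lp.single 2 σ 1)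

open Classical in
theorem sliceIn_apply (σ : Γ) (x : H) :
    sliceIn H σ x = HilbertTensor.mk (x ⊗ₜ[ℂ] (lp.single 2 σ 1 : EllTwo Γ)) := rfl

theorem norm_sliceIn_le (σ : Γ) : ‖sliceIn H σ‖ ≤ 1 :=
  ContinuousLinearMap.opNorm_le_bound _ zero_le_one fun x => by
    classical
    rw [sliceIn_apply, LinearIsometry.norm_map, TensorProduct.norm_tmul,
      lp.norm_single (by norm_num)]
    simp

variable {H}

/-- The vectors `x ⊗ δ_σ` span a dense subspace of `H ⊗ ℓ²(Γ)`. -/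
theorem ext_sliceIn {E : Type*} [NormedAddCommGroup E] [NormedSpace ℂ E]
    {P Q : HilbertTensor H (EllTwo Γ) →L[ℂ] E}
    (h : ∀ σ : Γ, P ∘L sliceIn H σ = Q ∘L sliceIn H σ) : P = Q := by
  classical
  refine ext_hilbertTensor fun x y => ?_
  have : P ∘L HilbertTensor.mk.toContinuousLinearMap ∘L TensorProduct.mkL ℂ H (EllTwo Γ) x =
      Q ∘L HilbertTensor.mk.toContinuousLinearMap ∘L TensorProduct.mkL ℂ H (EllTwo Γ) x := by
    refine lp.ext_continuousLinearMap (by norm_num) fun σ => ?_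
    ext
    exact congr($(h σ) x)
  exact congr($this y)

variable [CompleteSpace H]

/-- The adjoint `x ⊗ ξ ↦ ξ(ρ) x` of `sliceIn`. -/
noncomputable def sliceOut (ρ : Γ) : HilbertTensor H (EllTwo Γ) →L[ℂ] H :=
  ContinuousLinearMap.adjoint (sliceIn H ρ)

theorem sliceOut_mk (ρ : Γ) (x : H) (ξ : EllTwo Γ) :
    sliceOut ρ (HilbertTensor.mk (x ⊗ₜ[ℂ] ξ)) = ξ ρ • x := by
  classical
  refine ext_inner_left ℂ fun y => ?_
  rw [sliceOut, ContinuousLinearMap.adjoint_inner_right, sliceIn_apply,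
    LinearIsometry.inner_map_map, TensorProduct.inner_tmul, lp.inner_single_left, inner_smul_right]
  simp [mul_comm]

theorem eq_zero_of_sliceOut_eq_zero {v : HilbertTensor H (EllTwo Γ)}
    (h : ∀ ρ : Γ, sliceOut ρ v = 0) : v = 0 := by
  have h0 : innerSL ℂ v = 0 := ext_sliceIn fun σ => by
    ext x
    change ⟪v, sliceIn H σ x⟫_ℂ = 0
    rw [← ContinuousLinearMap.adjoint_inner_left]
    change ⟪sliceOut σ v, x⟫_ℂ = 0
    rw [h, inner_zero_left]
  have := congr($h0 v)
  simpa using this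

theorem norm_sliceOut_comp_comp_sliceIn_le (ρ σ : Γ) (P : TensorOp H Γ) :
    ‖sliceOut ρ ∘L P ∘L sliceIn H σ‖ ≤ ‖P‖ := by
  have hout : ‖(sliceOut ρ : HilbertTensor H (EllTwo Γ) →L[ℂ] H)‖ ≤ 1 := by
    rw [sliceOut, LinearIsometryEquiv.norm_map]
    exact norm_sliceIn_le H ρ
  calc ‖sliceOut ρ ∘L P ∘L sliceIn H σ‖
      ≤ ‖(sliceOut ρ : HilbertTensor H (EllTwo Γ) →L[ℂ] H)‖ * (‖P‖ * ‖sliceIn H σ‖) :=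
        (ContinuousLinearMap.opNorm_comp_le _ _).trans
          (mul_le_mul_of_nonneg_left (ContinuousLinearMap.opNorm_comp_le _ _) (norm_nonneg _))
    _ ≤ 1 * (‖P‖ * 1) := by gcongr; exact norm_sliceIn_le H σ
    _ = ‖P‖ := by ring

/-- The matrix entry at `(ρ, σ)` of an operator on `H ⊗ ℓ²(Γ)`, an operator on `H`. -/
noncomputable def matrixEntry (ρ σ : Γ) : TensorOp H Γ →L[ℂ] (H →L[ℂ] H) :=
  LinearMap.mkContinuous
    { toFun := fun P => sliceOut ρ ∘L P ∘L sliceIn H σ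
      map_add' := fun P Q => by ext; simp
      map_smul' := fun z P => by ext; simp } 1 fun P => by
    rw [one_mul]
    exact norm_sliceOut_comp_comp_sliceIn_le ρ σ P

theorem matrixEntry_apply (ρ σ : Γ)
    (P : TensorOp H Γ) :
    matrixEntry ρ σ P = sliceOut ρ ∘L P ∘L sliceIn H σ := rfl

theorem norm_matrixEntry_le (ρ σ : Γ) (P : TensorOp H Γ) : ‖matrixEntry ρ σ P‖ ≤ ‖P‖ :=
  norm_sliceOut_comp_comp_sliceIn_le ρ σ P

theorem ext_matrixEntry
    {P Q : TensorOp H Γ}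
    (h : ∀ ρ σ : Γ, matrixEntry ρ σ P = matrixEntry ρ σ Q) : P = Q := by
  refine ext_sliceIn fun σ => ?_
  ext x
  refine sub_eq_zero.1 (eq_zero_of_sliceOut_eq_zero fun ρ => ?_)
  rw [map_sub, sub_eq_zero]
  exact congr($(h ρ σ) x)

open Classical in
theorem matrixEntry_opTensor (ρ σ : Γ) (P : H →L[ℂ] H) (Q : EllTwo Γ →L[ℂ] EllTwo Γ) :
    matrixEntry ρ σ (opTensor P Q) = (Q (lp.single 2 σ 1)) ρ • P := by
  ext x
  simp [matrixEntry_apply, sliceIn_apply, sliceOut_mk]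

variable [Group Γ]

theorem sliceOut_comp_opTensor (P : H →L[ℂ] H) (γ ρ : Γ) :
    sliceOut ρ ∘L opTensor P (leftRegularRep Γ γ) = P ∘L sliceOut (γ⁻¹ * ρ) :=
  ext_hilbertTensor fun x ξ => by simp [sliceOut_mk]

theorem matrixEntry_opTensor_mul (P : H →L[ℂ] H) (γ ρ σ : Γ)
    (Q : TensorOp H Γ) :
    matrixEntry ρ σ (opTensor P (leftRegularRep Γ γ) * Q) = P * matrixEntry (γ⁻¹ * ρ) σ Q := by
  rw [matrixEntry_apply, matrixEntry_apply, ContinuousLinearMap.mul_def,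
    ← ContinuousLinearMap.comp_assoc, ← ContinuousLinearMap.comp_assoc, sliceOut_comp_opTensor]
  rfl

end Slices

/-! ### Matrix entries of elements of the spatial tensor product -/

section SpatialTensorEntries

variable {A H : Type*} [CStarAlgebra A] [NormedAddCommGroup H] [InnerProductSpace ℂ H]
  [CompleteSpace H] (π : A →⋆ₐ[ℂ] (H →L[ℂ] H)) {Γ : Type*} [Group Γ]

theorem SpatialTensor.coe_tmul_of (a : A) (γ : Γ) :
    (SpatialTensor.tmul π a (ReducedGroupCStar.of γ) : TensorOp H Γ) =
      opTensor (π a) (leftRegularRep Γ γ) :=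
  algTensorRep_tmul π a (ReducedGroupCStar.of γ)

theorem SpatialTensor.norm_tmul_of_le (a : A) (γ : Γ) :
    ‖SpatialTensor.tmul π a (ReducedGroupCStar.of γ)‖ ≤ ‖a‖ := by
  change ‖(SpatialTensor.tmul π a (ReducedGroupCStar.of γ) : TensorOp H Γ)‖ ≤ ‖a‖
  rw [SpatialTensor.coe_tmul_of]
  calc _ ≤ ‖π a‖ * ‖leftRegularRep Γ γ‖ := norm_opTensor_le _ _
    _ ≤ ‖a‖ * 1 := by
      gcongr
      · exact NonUnitalStarAlgHom.norm_apply_le π a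
      · exact norm_leftRegularRep_le γ
    _ = ‖a‖ := mul_one _

/-- The operators `π a ⊗ γ` span a dense subspace of the spatial tensor product. -/
theorem SpatialTensor.mem_topologicalClosure_span {P : TensorOp H Γ} (hP : P ∈ SpatialTensor π Γ) :
    P ∈ (Submodule.span ℂ (Set.range fun x : A × Γ =>
      opTensor (π x.1) (leftRegularRep Γ x.2))).topologicalClosure := by
  set W := (Submodule.span ℂ (Set.range fun x : A × Γ =>
      opTensor (π x.1) (leftRegularRep Γ x.2))).topologicalClosure
  have hWc : IsClosed (W : Set (TensorOp H Γ)) :=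
    Submodule.isClosed_topologicalClosure _
  have hgen : ∀ (a : A) (γ : Γ), opTensor (π a) (leftRegularRep Γ γ) ∈ W := fun a γ =>
    Submodule.le_topologicalClosure _ (Submodule.subset_span ⟨(a, γ), rfl⟩)
  have halg : ∀ x : MonoidAlgebra ℂ Γ, ∀ a : A, opTensor (π a) (groupAlgebraRep Γ x) ∈ W := by
    intro x
    induction x using MonoidAlgebra.induction_on with
    | of γ => intro a; rw [groupAlgebraRep_of]; exact hgen a γ
    | add x y hx hy =>
      intro a; rw [map_add, opTensor_add_right]; exact add_mem (hx a) (hy a)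
    | smul z x hx =>
      intro a; rw [map_smul, opTensor_smul_right, ← map_smul]; exact hx (z • a)
  have hred : ∀ (a : A) (c : ReducedGroupCStar Γ),
      opTensor (π a) (c : EllTwo Γ →L[ℂ] EllTwo Γ) ∈ W := by
    intro a c
    have hcl : IsClosed {Q : EllTwo Γ →L[ℂ] EllTwo Γ | opTensor (π a) Q ∈ W} :=
      hWc.preimage (continuous_opTensor_right (π a))
    refine closure_minimal ?_ hcl c.2
    rintro _ ⟨x, rfl⟩
    exact halg x a
  refine closure_minimal ?_ hWc hP
  rintro _ ⟨x, rfl⟩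
  change algTensorRep π Γ x ∈ W
  induction x using TensorProduct.induction_on with
  | zero => rw [map_zero]; exact zero_mem _
  | add x y hx hy => rw [map_add]; exact add_mem hx hy
  | tmul a c => rw [algTensorRep_tmul]; exact hred a c

/-- The elements of the spatial tensor product commute with the right translations, so their
matrix entries depend on `ρ σ⁻¹` only. -/
theorem SpatialTensor.matrixEntry_eq {P : TensorOp H Γ} (hP : P ∈ SpatialTensor π Γ) (ρ σ : Γ) :
    matrixEntry ρ σ P = matrixEntry (ρ * σ⁻¹) 1 P := by
  have hcl : IsClosed ((LinearMap.eqLocus (matrixEntry (H := H) ρ σ).toLinearMap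
      (matrixEntry (ρ * σ⁻¹) 1).toLinearMap : Submodule ℂ _) : Set (TensorOp H Γ)) :=
    isClosed_eq (matrixEntry (H := H) ρ σ).continuous (matrixEntry (ρ * σ⁻¹) 1).continuous
  refine Submodule.topologicalClosure_minimal _ (Submodule.span_le.2 ?_) hcl
    (SpatialTensor.mem_topologicalClosure_span π hP)
  rintro _ ⟨⟨a, γ⟩, rfl⟩
  classical
  change matrixEntry ρ σ _ = matrixEntry (ρ * σ⁻¹) 1 _
  simp [matrixEntry_opTensor, lp.single_apply, Pi.single_apply, inv_mul_eq_iff_eq_mul,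
    mul_inv_eq_iff_eq_mul]

theorem SpatialTensor.ext_matrixEntry {b c : SpatialTensor π Γ}
    (h : ∀ γ : Γ, matrixEntry γ 1 (b : TensorOp H Γ) =
      matrixEntry γ 1 (c : TensorOp H Γ)) :
    b = c :=
  Subtype.ext <| _root_.ext_matrixEntry fun ρ σ => by
    rw [SpatialTensor.matrixEntry_eq π b.2, SpatialTensor.matrixEntry_eq π c.2, h]

/-- Since `π A` is closed, the coefficients of an element of the spatial tensor product
belong to it. -/
theorem SpatialTensor.matrixEntry_mem_range (hπ : Function.Injective π)
    {P : TensorOp H Γ} (hP : P ∈ SpatialTensor π Γ) (ρ σ : Γ) :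
    ∃ a : A, π a = matrixEntry ρ σ P := by
  have hiso : Isometry π := AddMonoidHomClass.isometry_of_norm π
    (NonUnitalStarAlgHom.norm_map π hπ)
  have hcl : IsClosed ((LinearMap.range π.toAlgHom.toLinearMap).comap
      (matrixEntry ρ σ).toLinearMap : Set (TensorOp H Γ)) :=
    IsClosed.preimage (f := matrixEntry ρ σ) (matrixEntry ρ σ).continuous
      hiso.isClosedEmbedding.isClosed_range
  refine Submodule.topologicalClosure_minimal _ (Submodule.span_le.2 ?_) hcl
    (SpatialTensor.mem_topologicalClosure_span π hP)
  rintro _ ⟨⟨a, γ⟩, rfl⟩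
  classical
  change ∃ a' : A, π a' = matrixEntry ρ σ (opTensor (π a) (leftRegularRep Γ γ))
  rw [matrixEntry_opTensor]
  exact ⟨_ • a, map_smul π _ a⟩

open Classical in
theorem SpatialTensor.matrixEntry_tmul_of (a : A) (γ ρ : Γ) :
    matrixEntry ρ 1 (SpatialTensor.tmul π a (ReducedGroupCStar.of γ) : TensorOp H Γ) =
      if γ = ρ then π a else 0 := by
  rw [SpatialTensor.coe_tmul_of, matrixEntry_opTensor]
  simp only [leftRegularRep_apply, lp.single_apply, Pi.single_apply, inv_mul_eq_one]
  split_ifs <;> simp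

end SpatialTensorEntries

/-! ### Commutators with multiplication operators -/

section Multiplication

variable {Γ : Type*}

theorem memℓp_infty_mul_two (f : lp (fun _ : Γ => ℂ) ∞) (ξ : EllTwo Γ) :
    Memℓp (fun ρ => f ρ * ξ ρ) 2 := by
  refine ((lp.memℓp ξ).norm.const_mul ‖f‖).mono fun ρ => ?_
  rw [norm_mul]
  exact mul_le_mul_of_nonneg_right (lp.norm_apply_le_norm (by simp) f ρ) (norm_nonneg _)

/-- Multiplication by a bounded function on `ℓ²(Γ)`. -/
noncomputable def multiplicationOp (f : lp (fun _ : Γ => ℂ) ∞) : EllTwo Γ →L[ℂ] EllTwo Γ :=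
  LinearMap.mkContinuous
    { toFun := fun ξ => ⟨fun ρ => f ρ * ξ ρ, memℓp_infty_mul_two f ξ⟩
      map_add' := fun ξ η => lp.ext (funext fun ρ => mul_add (f ρ) (ξ ρ) (η ρ))
      map_smul' := fun z ξ => lp.ext (funext fun ρ => mul_left_comm (f ρ) z (ξ ρ)) }
    ‖f‖ fun ξ => by
    have hnorm : ‖((‖f‖ : ℂ) • ξ)‖ = ‖f‖ * ‖ξ‖ := by
      rw [norm_smul, Complex.norm_real, norm_norm]
    rw [← hnorm]
    refine lp.norm_mono (by norm_num) fun ρ => ?_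
    change ‖f ρ * ξ ρ‖ ≤ ‖(‖f‖ : ℂ) * ξ ρ‖
    rw [norm_mul, norm_mul, Complex.norm_real, norm_norm]
    exact mul_le_mul_of_nonneg_right (lp.norm_apply_le_norm (by simp) f ρ) (norm_nonneg _)

@[simp]
theorem multiplicationOp_apply (f : lp (fun _ : Γ => ℂ) ∞) (ξ : EllTwo Γ) (ρ : Γ) :
    multiplicationOp f ξ ρ = f ρ * ξ ρ := rfl

theorem norm_multiplicationOp_le (f : lp (fun _ : Γ => ℂ) ∞) : ‖multiplicationOp f‖ ≤ ‖f‖ :=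
  LinearMap.mkContinuous_norm_le _ (norm_nonneg _) _

variable {H : Type*} [NormedAddCommGroup H] [InnerProductSpace ℂ H]

/-- As `γ f = f(γ⁻¹ ·) γ` in the operators on `ℓ²(Γ)`, commutators of `P ⊗ γ` with a multiplication
operator `f` multiply it by the function `f - f(γ⁻¹ ·)`. -/
theorem innerDerivation_multiplicationOp_pow [Group Γ] {f d : lp (fun _ : Γ => ℂ) ∞} {γ : Γ}
    (hd : ∀ ρ, d ρ = f ρ - f (γ⁻¹ * ρ)) (P : H →L[ℂ] H) (k : ℕ) :
    (innerDerivation (opTensor 1 (multiplicationOp f)) ^ k)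
        (opTensor P (leftRegularRep Γ γ)) =
      opTensor P (multiplicationOp (d ^ k) * leftRegularRep Γ γ) := by
  induction k with
  | zero =>
    rw [pow_zero, pow_zero, one_apply_eq_self]
    congr 1
    ext ξ ρ
    simp
  | succ k ih =>
    rw [innerDerivation_pow_succ', ih, innerDerivation_apply, opTensor_mul, opTensor_mul, one_mul,
      mul_one, ← opTensor_sub_right]
    congr 1
    ext ξ ρ
    simp only [sub_apply, mul_apply_eq_comp, lp.coeFn_sub,
      Pi.sub_apply, multiplicationOp_apply, leftRegularRep_apply, pow_succ, lp.infty_coeFn_mul,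
      Pi.mul_apply, hd]
    ring

variable [CompleteSpace H]

/-- On matrix entries, the commutator with a multiplication operator `f` is multiplication by
`f(ρ) - f(σ)`. -/
theorem matrixEntry_innerDerivation_pow (f : lp (fun _ : Γ => ℂ) ∞) (ρ σ : Γ)
    (P : TensorOp H Γ) (k : ℕ) :
    matrixEntry ρ σ ((innerDerivation (opTensor 1 (multiplicationOp f)) ^ k) P) =
      (f ρ - f σ) ^ k • matrixEntry ρ σ P := by
  classical
  have hout : sliceOut ρ ∘L opTensor 1 (multiplicationOp f) =
      f ρ • (sliceOut ρ : HilbertTensor H (EllTwo Γ) →L[ℂ] H) :=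
    ext_hilbertTensor fun x ξ => by simp [sliceOut_mk, mul_smul]
  have hin : opTensor 1 (multiplicationOp f) ∘L sliceIn H σ = f σ • sliceIn H σ := by
    ext x
    simp only [ContinuousLinearMap.comp_apply, smul_apply, sliceIn_apply,
      opTensor_mk, TensorProduct.mapL_tmul, ← map_smul, ← TensorProduct.tmul_smul]
    congr 2
    ext τ
    by_cases h : τ = σ
    · subst h; simp
    · simp [lp.single_apply, h]
  induction k generalizing P with
  | zero => simp
  | succ k ih =>
    rw [innerDerivation_pow_succ, ih, pow_succ, mul_smul]
    congr 1
    ext x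
    have h1 : sliceOut ρ (opTensor 1 (multiplicationOp f) (P (sliceIn H σ x))) =
        f ρ • sliceOut ρ (P (sliceIn H σ x)) := congr($hout (P (sliceIn H σ x)))
    have h2 : opTensor 1 (multiplicationOp f) (sliceIn H σ x) = f σ • sliceIn H σ x :=
      congr($hin x)
    change sliceOut ρ (opTensor 1 (multiplicationOp f) (P (sliceIn H σ x)) -
      P (opTensor 1 (multiplicationOp f) (sliceIn H σ x))) =
        (f ρ - f σ) • sliceOut ρ (P (sliceIn H σ x))
    rw [map_sub, h1, h2, map_smul, map_smul, sub_smul]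

end Multiplication

/-! ### Word length -/

section WordLength

variable {Γ : Type*} [Group Γ] {S : Finset Γ}

theorem wordLength_one : wordLength S (1 : Γ) = 0 :=
  Nat.sInf_eq_zero.2 (Or.inl ⟨[], rfl, by simp, rfl⟩)

theorem wordLength_prod_le {l : List Γ} (hl : ∀ x ∈ l, x ∈ S) : wordLength S l.prod ≤ l.length :=
  Nat.sInf_le ⟨l, rfl, hl, rfl⟩

/-- The infimum that defines the word length is attained, since `S = S⁻¹` generates `Γ`. -/
theorem exists_word (hgen : Subgroup.closure (S : Set Γ) = ⊤) (hinv : ∀ γ ∈ S, γ⁻¹ ∈ S) (γ : Γ) :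
    ∃ l : List Γ, l.length = wordLength S γ ∧ (∀ x ∈ l, x ∈ S) ∧ l.prod = γ := by
  refine Nat.sInf_mem (s := {n | ∃ l : List Γ, l.length = n ∧ (∀ x ∈ l, x ∈ S) ∧ l.prod = γ}) ?_
  obtain ⟨l, hl, hp⟩ := Submonoid.exists_list_of_mem_closure
    (show γ ∈ Submonoid.closure ((S : Set Γ) ∪ (S : Set Γ)⁻¹) by
      rw [← Subgroup.closure_toSubmonoid, hgen]; trivial)
  refine ⟨_, l, rfl, fun x hx => ?_, hp⟩
  rcases hl x hx with h | h
  · exact h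
  · simpa using hinv _ h

theorem wordLength_mul_le (hgen : Subgroup.closure (S : Set Γ) = ⊤) (hinv : ∀ γ ∈ S, γ⁻¹ ∈ S)
    (γ ρ : Γ) : wordLength S (γ * ρ) ≤ wordLength S γ + wordLength S ρ := by
  obtain ⟨l, hl, hlS, rfl⟩ := exists_word hgen hinv γ
  obtain ⟨m, hm, hmS, rfl⟩ := exists_word hgen hinv ρ
  rw [← hl, ← hm, ← List.prod_append, ← List.length_append]
  refine wordLength_prod_le fun x hx => ?_
  rcases List.mem_append.1 hx with h | h
  exacts [hlS x h, hmS x h]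

theorem wordLength_inv_le (hgen : Subgroup.closure (S : Set Γ) = ⊤) (hinv : ∀ γ ∈ S, γ⁻¹ ∈ S)
    (γ : Γ) : wordLength S γ⁻¹ ≤ wordLength S γ := by
  obtain ⟨l, hl, hlS, rfl⟩ := exists_word hgen hinv γ
  rw [← hl, List.prod_inv_reverse]
  refine (wordLength_prod_le fun x hx => ?_).trans_eq (by simp)
  obtain ⟨y, hy, rfl⟩ := List.mem_map.1 (List.mem_reverse.1 hx)
  exact hinv y (hlS y hy)

variable (S) in
/-- The truncated word length `min L n`, a bounded function on `Γ`. -/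
noncomputable def truncatedLength (n : ℕ) : lp (fun _ : Γ => ℂ) ∞ :=
  ⟨fun γ => ((min (wordLength S γ) n : ℕ) : ℂ), memℓp_infty ⟨n, by
    rintro _ ⟨γ, rfl⟩
    simp only [Complex.norm_natCast, Nat.cast_le]
    exact min_le_right _ _⟩⟩

theorem truncatedLength_apply (n : ℕ) (γ : Γ) :
    truncatedLength S n γ = ((min (wordLength S γ) n : ℕ) : ℂ) := rfl

/-- The truncated lengths are `1`-Lipschitz for the word metric, uniformly in `n`: this is what
bounds the commutators with them. -/
theorem norm_truncatedLength_sub_le (hgen : Subgroup.closure (S : Set Γ) = ⊤)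
    (hinv : ∀ γ ∈ S, γ⁻¹ ∈ S) (n : ℕ) (γ ρ : Γ) :
    ‖truncatedLength S n ρ - truncatedLength S n (γ⁻¹ * ρ)‖ ≤ wordLength S γ := by
  have h1 : wordLength S ρ ≤ wordLength S γ + wordLength S (γ⁻¹ * ρ) := by
    simpa using wordLength_mul_le hgen hinv γ (γ⁻¹ * ρ)
  have h2 : wordLength S (γ⁻¹ * ρ) ≤ wordLength S γ + wordLength S ρ :=
    (wordLength_mul_le hgen hinv γ⁻¹ ρ).trans
      (Nat.add_le_add_right (wordLength_inv_le hgen hinv γ) _)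
  have h3 : min (wordLength S ρ) n ≤ min (wordLength S (γ⁻¹ * ρ)) n + wordLength S γ := by lia
  have h4 : min (wordLength S (γ⁻¹ * ρ)) n ≤ min (wordLength S ρ) n + wordLength S γ := by lia
  rw [truncatedLength_apply, truncatedLength_apply]
  generalize min (wordLength S ρ) n = p at h3 h4 ⊢
  generalize min (wordLength S (γ⁻¹ * ρ)) n = q at h3 h4 ⊢
  rw [← Complex.ofReal_natCast, ← Complex.ofReal_natCast, ← Complex.ofReal_sub, Complex.norm_real,
    Real.norm_eq_abs, abs_sub_le_iff, sub_le_iff_le_add', sub_le_iff_le_add']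
  exact ⟨mod_cast h3, mod_cast h4⟩

theorem exists_norm_le_truncatedLength_sub (hgen : Subgroup.closure (S : Set Γ) = ⊤)
    (hinv : ∀ γ ∈ S, γ⁻¹ ∈ S) (n : ℕ) (γ : Γ) :
    ∃ d : lp (fun _ : Γ => ℂ) ∞,
      (∀ ρ, d ρ = truncatedLength S n ρ - truncatedLength S n (γ⁻¹ * ρ)) ∧
        ‖d‖ ≤ wordLength S γ :=
  ⟨⟨fun ρ => truncatedLength S n ρ - truncatedLength S n (γ⁻¹ * ρ), memℓp_infty
      ⟨wordLength S γ, by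
        rintro _ ⟨ρ, rfl⟩
        exact norm_truncatedLength_sub_le hgen hinv n γ ρ⟩⟩,
    fun _ => rfl,
    lp.norm_le_of_forall_le (Nat.cast_nonneg _)
      (norm_truncatedLength_sub_le hgen hinv n γ)⟩

end WordLength

/-! ### Rapidly decreasing sequences -/

section RapidDecay

variable {Γ : Type*} [Group Γ] {S : Finset Γ} {A : Type*} [NormedAddCommGroup A] [NormedSpace ℂ A]

theorem one_add_rpow_le {x s : ℝ} (hx : 0 ≤ x) (hs : 0 ≤ s) :
    (1 + x) ^ s ≤ 2 ^ s * (1 + x ^ s) := by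
  have h2 : (0 : ℝ) ≤ 2 ^ s := by positivity
  have hxs : 0 ≤ x ^ s := by positivity
  rcases le_total x 1 with h | h
  · calc (1 + x) ^ s ≤ 2 ^ s := Real.rpow_le_rpow (by positivity) (by linarith) hs
      _ ≤ 2 ^ s * (1 + x ^ s) := le_mul_of_one_le_right h2 (by linarith)
  · calc (1 + x) ^ s ≤ (2 * x) ^ s := Real.rpow_le_rpow (by positivity) (by linarith) hs
      _ = 2 ^ s * x ^ s := Real.mul_rpow (by norm_num) hx
      _ ≤ 2 ^ s * (1 + x ^ s) := by gcongr; linarith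

theorem HInfty.summable_sq_mul_one_add_rpow (a : HInfty S A) {s : ℝ} (hs : 0 ≤ s) :
    Summable fun γ => ‖(a : Γ → A) γ‖ ^ 2 * (1 + (wordLength S γ : ℝ)) ^ s := by
  -- The weight `1` is the case `s = 0` of the definition of `HInfty`.
  have h0 := a.2 0 le_rfl
  refine Summable.of_nonneg_of_le (fun γ => by positivity) (fun γ => ?_)
    ((h0.add (a.2 s hs)).mul_left (2 ^ s))
  calc _ ≤ ‖(a : Γ → A) γ‖ ^ 2 * (2 ^ s * (1 + (wordLength S γ : ℝ) ^ s)) := by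
        gcongr; exact one_add_rpow_le (Nat.cast_nonneg _) hs
    _ = _ := by rw [Real.rpow_zero]; ring

theorem HInfty.summable_norm_mul_pow (hpoly : HasPolynomialGrowth S) (a : HInfty S A) (k : ℕ) :
    Summable fun γ => ‖(a : Γ → A) γ‖ * (wordLength S γ : ℝ) ^ k := by
  obtain ⟨s, hs, hsum⟩ := hpoly
  refine Summable.of_nonneg_of_le (fun γ => by positivity) (fun γ => ?_)
    ((HInfty.summable_sq_mul_one_add_rpow a (s := s + (2 * k : ℕ)) (by positivity)).add hsum)
  have h1 : 0 < 1 + (wordLength S γ : ℝ) := by positivity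
  set x := ‖(a : Γ → A) γ‖
  set w := 1 + (wordLength S γ : ℝ)
  have hx : 0 ≤ x := norm_nonneg _
  have hL : (wordLength S γ : ℝ) ^ k ≤ w ^ k := by gcongr; simp [w]
  -- `2 x wᵏ ≤ x² wˢ⁺²ᵏ + w⁻ˢ`, by the inequality between the two means
  have hu : w ^ s * w ^ (-s) = 1 := by rw [← Real.rpow_add h1]; simp
  have hp : 0 < w ^ s := by positivity
  have hq : 0 < w ^ (-s) := by positivity
  rw [Real.rpow_add h1, Real.rpow_natCast, pow_mul']
  refine (mul_le_mul_of_nonneg_left hL hx).trans ?_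
  set u := w ^ s
  set v := w ^ (-s)
  set y := x * w ^ k with hy
  have hy0 : 0 ≤ y := by positivity
  have h3 : x ^ 2 * (u * (w ^ k) ^ 2) = u * y ^ 2 := by rw [hy]; ring
  rw [h3]
  have h4 : v * (u * y - 1) ^ 2 = u * y ^ 2 + v - 2 * y := by
    linear_combination (u * y ^ 2 - 2 * y) * hu
  have h5 : 0 ≤ v * (u * y - 1) ^ 2 := by positivity
  linarith

theorem mem_HInfty_of_bounded (hpoly : HasPolynomialGrowth S) {a : Γ → A}
    (ha : ∀ k : ℕ, ∃ C : ℝ, ∀ γ, ‖a γ‖ * (wordLength S γ : ℝ) ^ k ≤ C) : a ∈ HInfty S A := by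
  intro t ht
  obtain ⟨s, hs, hsum⟩ := hpoly
  obtain ⟨k, hk⟩ := exists_nat_ge (t + s)
  obtain ⟨C₀, hC₀⟩ := ha 0
  obtain ⟨C, hC⟩ := ha k
  refine Summable.of_nonneg_of_le (fun γ => by positivity) (fun γ => ?_)
    (hsum.mul_left (C₀ * (2 ^ k * (C₀ + C))))
  have h1 : 1 ≤ 1 + (wordLength S γ : ℝ) := by simp
  have h0 : 0 < 1 + (wordLength S γ : ℝ) := by positivity
  have hC₀' : ‖a γ‖ ≤ C₀ := by simpa using hC₀ γ
  have hC' := hC γ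
  have hk' : (1 + (wordLength S γ : ℝ)) ^ k ≤ 2 ^ k * (1 + (wordLength S γ : ℝ) ^ k) := by
    simpa using one_add_rpow_le (x := wordLength S γ) (s := k) (Nat.cast_nonneg _)
      (Nat.cast_nonneg _)
  have hw : (wordLength S γ : ℝ) ^ t ≤
      (1 + (wordLength S γ : ℝ)) ^ k * (1 + (wordLength S γ : ℝ)) ^ (-s) := by
    rw [← Real.rpow_natCast, ← Real.rpow_add h0]
    calc (wordLength S γ : ℝ) ^ t ≤ (1 + (wordLength S γ : ℝ)) ^ t :=
          Real.rpow_le_rpow (Nat.cast_nonneg _) (by simp) ht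
      _ ≤ _ := Real.rpow_le_rpow_of_exponent_le h1 (by linarith)
  have hak : ‖a γ‖ * (1 + (wordLength S γ : ℝ)) ^ k ≤ 2 ^ k * (C₀ + C) := by
    calc _ ≤ ‖a γ‖ * (2 ^ k * (1 + (wordLength S γ : ℝ) ^ k)) := by gcongr
      _ = 2 ^ k * (‖a γ‖ + ‖a γ‖ * (wordLength S γ : ℝ) ^ k) := by ring
      _ ≤ _ := by gcongr
  calc ‖a γ‖ ^ 2 * (wordLength S γ : ℝ) ^ t
      ≤ ‖a γ‖ ^ 2 * ((1 + (wordLength S γ : ℝ)) ^ k * (1 + (wordLength S γ : ℝ)) ^ (-s)) := by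
        gcongr
    _ = ‖a γ‖ * (‖a γ‖ * (1 + (wordLength S γ : ℝ)) ^ k) *
        (1 + (wordLength S γ : ℝ)) ^ (-s) := by ring
    _ ≤ C₀ * (2 ^ k * (C₀ + C)) * (1 + (wordLength S γ : ℝ)) ^ (-s) := by
        gcongr
        exact (norm_nonneg _).trans hC₀'

end RapidDecay

/-! ### The smooth elements of the spatial tensor product -/

section Smooth

variable {Γ : Type*} [Group Γ] (S : Finset Γ)
  {A H : Type*} [CStarAlgebra A] [NormedAddCommGroup H] [InnerProductSpace ℂ H]
  [CompleteSpace H] (π : A →⋆ₐ[ℂ] (H →L[ℂ] H))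

variable (H) in
/-- Multiplication by the truncated length `min L n` on the second factor of `H ⊗ ℓ²(Γ)`. -/
noncomputable def lengthOp (n : ℕ) : TensorOp H Γ :=
  opTensor 1 (multiplicationOp (truncatedLength S n))

/-- The elements of the spatial tensor product all of whose iterated commutators with the truncated
length operators are bounded uniformly in the truncation. This stands for boundedness of the
iterated commutators with the unbounded operator `1 ⊗ L`. -/
noncomputable def smoothSubalgebra : Subalgebra ℂ (SpatialTensor π Γ) where
  carrier := {b | ∀ k, BoundedUpTo (lengthOp S H) (fun _ => (b : TensorOp H Γ)) k}
  mul_mem' hb hc k := (hb k).mul (hc k)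
  add_mem' hb hc k := (hb k).add (hc k)
  algebraMap_mem' z k := by
    have := (BoundedUpTo.one (D := lengthOp S H) (k := k)).smul (c := fun _ => z) fun _ => le_rfl
    convert this using 2
    exact Algebra.algebraMap_eq_smul_one z

variable {S π}

theorem mem_smoothSubalgebra_iff {b : SpatialTensor π Γ} : b ∈ smoothSubalgebra S π ↔
    ∀ k, ∃ C : ℝ, ∀ n, ‖(innerDerivation (lengthOp S H n) ^ k) (b : TensorOp H Γ)‖ ≤ C :=
  ⟨fun h k => h k k le_rfl, fun h _ j _ => h j⟩

/-- A commutator with the length function multiplies `a ⊗ γ` by a function bounded by `L(γ)`. -/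
theorem norm_innerDerivation_pow_tmul_of_le (hgen : Subgroup.closure (S : Set Γ) = ⊤)
    (hinv : ∀ γ ∈ S, γ⁻¹ ∈ S) (a : A) (γ : Γ) (k n : ℕ) :
    ‖(innerDerivation (lengthOp S H n) ^ k)
      (SpatialTensor.tmul π a (ReducedGroupCStar.of γ) : TensorOp H Γ)‖ ≤
        ‖a‖ * (wordLength S γ : ℝ) ^ k := by
  obtain ⟨d, hd, hdn⟩ := exists_norm_le_truncatedLength_sub hgen hinv n γ
  rw [SpatialTensor.coe_tmul_of, lengthOp, innerDerivation_multiplicationOp_pow hd]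
  calc _ ≤ ‖π a‖ * ‖multiplicationOp (d ^ k) * leftRegularRep Γ γ‖ := norm_opTensor_le _ _
    _ ≤ ‖a‖ * (‖multiplicationOp (d ^ k)‖ * ‖leftRegularRep Γ γ‖) := by
      gcongr
      · exact NonUnitalStarAlgHom.norm_apply_le π a
      · exact norm_mul_le _ _
    _ ≤ ‖a‖ * ((wordLength S γ : ℝ) ^ k * 1) := by
      gcongr
      · calc _ ≤ ‖d ^ k‖ := norm_multiplicationOp_le _
          _ ≤ ‖d‖ ^ k := norm_pow_le d k
          _ ≤ _ := by gcongr
      · exact norm_leftRegularRep_le γ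
    _ = _ := by rw [mul_one]

theorem tmul_of_mem_smoothSubalgebra (hgen : Subgroup.closure (S : Set Γ) = ⊤)
    (hinv : ∀ γ ∈ S, γ⁻¹ ∈ S) (a : A) (γ : Γ) :
    SpatialTensor.tmul π a (ReducedGroupCStar.of γ) ∈ smoothSubalgebra S π :=
  mem_smoothSubalgebra_iff.2 fun k =>
    ⟨_, fun n => norm_innerDerivation_pow_tmul_of_le hgen hinv a γ k n⟩

/-- The coefficients of a smooth element decay rapidly. Since `L(1) = 0`, the coefficient at `γ` of
a `k`-fold commutator with `min L n` is `L(γ)ᵏ` times that of the element, as soon as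
`n ≥ L(γ)`. -/
theorem bounded_matrixEntry_of_mem_smoothSubalgebra {b : SpatialTensor π Γ}
    (hb : b ∈ smoothSubalgebra S π) (k : ℕ) :
    ∃ C : ℝ, ∀ γ : Γ,
      ‖matrixEntry γ 1 (b : TensorOp H Γ)‖ * (wordLength S γ : ℝ) ^ k ≤ C := by
  obtain ⟨C, hC⟩ := mem_smoothSubalgebra_iff.1 hb k
  refine ⟨C, fun γ => ?_⟩
  have h := (norm_matrixEntry_le γ 1 _).trans (hC (wordLength S γ))
  rw [lengthOp, matrixEntry_innerDerivation_pow, norm_smul, truncatedLength_apply,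
    truncatedLength_apply, wordLength_one] at h
  simpa [mul_comm] using h

theorem isSpectralSubalgebra_smoothSubalgebra : IsSpectralSubalgebra (smoothSubalgebra S π) := by
  intro u hu k
  refine (hu k).inverse (fun _ => ?_) (fun _ => ?_) ⟨‖((u⁻¹ : (SpatialTensor π Γ)ˣ) :
    SpatialTensor π Γ)‖, fun _ => le_rfl⟩
  · exact congr_arg Subtype.val u.mul_inv
  · exact congr_arg Subtype.val u.inv_mul

theorem dense_smoothSubalgebra (hgen : Subgroup.closure (S : Set Γ) = ⊤)
    (hinv : ∀ γ ∈ S, γ⁻¹ ∈ S) :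
    Dense (smoothSubalgebra S π : Set (SpatialTensor π Γ)) := by
  rw [Subtype.dense_iff]
  intro P hP
  refine closure_mono ?_ (SpatialTensor.mem_topologicalClosure_span π hP)
  change ((Submodule.span ℂ _ : Submodule ℂ (TensorOp H Γ)) : Set (TensorOp H Γ)) ⊆
    ((smoothSubalgebra S π).map (SpatialTensor π Γ).subtype.toAlgHom : Subalgebra ℂ (TensorOp H Γ))
  refine Submodule.span_le (p := Subalgebra.toSubmodule
    ((smoothSubalgebra S π).map (SpatialTensor π Γ).subtype.toAlgHom)) |>.2 ?_
  rintro _ ⟨⟨a, γ⟩, rfl⟩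
  exact ⟨_, tmul_of_mem_smoothSubalgebra hgen hinv a γ, SpatialTensor.coe_tmul_of π a γ⟩

end Smooth

/-! ### Holomorphic functional calculus -/

section HolomorphicCalculus

variable {Γ : Type*} [Group Γ] {S : Finset Γ}
  {A H : Type*} [CStarAlgebra A] [NormedAddCommGroup H] [InnerProductSpace ℂ H]
  [CompleteSpace H] {π : A →⋆ₐ[ℂ] (H →L[ℂ] H)}

variable (π Γ) in
/-- The inclusion of the spatial tensor product in the bounded operators. -/
noncomputable def SpatialTensor.inclusion : SpatialTensor π Γ →L[ℂ] TensorOp H Γ :=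
  ⟨(SpatialTensor π Γ).subtype.toAlgHom.toLinearMap, continuous_subtype_val⟩

theorem SpatialTensor.inclusion_apply (b : SpatialTensor π Γ) :
    SpatialTensor.inclusion Γ π b = b := rfl

theorem continuousOn_resolvent {B : Type*} [CStarAlgebra B] (b : B) :
    ContinuousOn (resolvent b) (spectrum ℂ b)ᶜ := fun _ hz =>
  (spectrum.hasDerivAt_resolvent_const_left
    (spectrum.notMem_iff.1 hz)).continuousAt.continuousWithinAt

/-- Along a compact curve in the resolvent set of a smooth element, the commutators of the
resolvents are bounded uniformly in the point of the curve and in the truncation. -/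
theorem exists_norm_innerDerivation_pow_resolvent_le {b : SpatialTensor π Γ}
    (hb : b ∈ smoothSubalgebra S π) {p : ℝ → ℂ} (hp : ContinuousOn p (Set.Icc 0 1))
    (hpb : Set.MapsTo p (Set.Icc 0 1) (spectrum ℂ b)ᶜ) (k : ℕ) :
    ∃ C : ℝ, ∀ (n : ℕ), ∀ t ∈ Set.Icc (0 : ℝ) 1,
      ‖(innerDerivation (lengthOp S H n) ^ k)
        (SpatialTensor.inclusion Γ π (resolvent b (p t)))‖ ≤ C := by
  obtain ⟨M, hM⟩ := isCompact_Icc.exists_bound_of_continuousOn hp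
  obtain ⟨R, hR⟩ := isCompact_Icc.exists_bound_of_continuousOn
    ((continuousOn_resolvent b).comp hp hpb)
  let D : ℕ × Set.Icc (0 : ℝ) 1 → TensorOp H Γ := fun i => lengthOp S H i.1
  have hbD : BoundedUpTo D (fun _ => (b : TensorOp H Γ)) k := fun j hj => by
    obtain ⟨C, hC⟩ := hb k j hj
    exact ⟨C, fun i => hC i.1⟩
  have hX : BoundedUpTo D (fun i => p i.2 • (1 : TensorOp H Γ) + -(b : TensorOp H Γ)) k :=
    (BoundedUpTo.one.smul (c := fun i : ℕ × Set.Icc (0 : ℝ) 1 => p i.2) (M := M)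
      fun i => hM i.2 i.2.2).add hbD.neg
  have hXc : ∀ i : ℕ × Set.Icc (0 : ℝ) 1, p i.2 • (1 : TensorOp H Γ) + -(b : TensorOp H Γ) =
      ((algebraMap ℂ (SpatialTensor π Γ) (p i.2) - b : SpatialTensor π Γ) : TensorOp H Γ) := by
    intro i
    rw [← sub_eq_add_neg, Algebra.algebraMap_eq_smul_one]
    rfl
  have hY : BoundedUpTo D (fun i => SpatialTensor.inclusion Γ π (resolvent b (p i.2))) k := by
    refine hX.inverse (fun i => ?_) (fun i => ?_) ⟨R, fun i => hR i.2 i.2.2⟩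
    · rw [hXc]
      exact congr_arg Subtype.val (Ring.mul_inverse_cancel _ (spectrum.notMem_iff.1 (hpb i.2.2)))
    · rw [hXc]
      exact congr_arg Subtype.val (Ring.inverse_mul_cancel _ (spectrum.notMem_iff.1 (hpb i.2.2)))
  obtain ⟨C, hC⟩ := hY k le_rfl
  exact ⟨C, fun n t ht => hC (n, ⟨t, ht⟩)⟩

theorem integral_mem_smoothSubalgebra {F : ℝ → SpatialTensor π Γ}
    (hF : IntervalIntegrable F MeasureTheory.volume 0 1)
    (hb : ∀ k, ∃ C : ℝ, ∀ (n : ℕ), ∀ t ∈ Set.Icc (0 : ℝ) 1,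
      ‖(innerDerivation (lengthOp S H n) ^ k) (SpatialTensor.inclusion Γ π (F t))‖ ≤ C) :
    ∫ t in (0 : ℝ)..1, F t ∈ smoothSubalgebra S π := by
  refine mem_smoothSubalgebra_iff.2 fun k => ?_
  obtain ⟨C, hC⟩ := hb k
  refine ⟨C, fun n => ?_⟩
  have hcomm := ((innerDerivation (lengthOp S H n) ^ k) ∘L
    SpatialTensor.inclusion Γ π).intervalIntegral_comp_comm hF
  rw [← SpatialTensor.inclusion_apply, ← ContinuousLinearMap.comp_apply, ← hcomm]
  refine (intervalIntegral.norm_integral_le_of_norm_le_const (C := C)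
    fun t ht => ?_).trans_eq (by simp)
  rw [Set.uIoc_of_le zero_le_one] at ht
  exact hC n t (Set.Ioc_subset_Icc_self ht)

theorem integral_resolvent_mem_smoothSubalgebra {b : SpatialTensor π Γ}
    (hb : b ∈ smoothSubalgebra S π) {p : ℝ → ℂ} (hp : ContDiffOn ℝ 1 p (Set.Icc 0 1))
    (hpb : Set.MapsTo p (Set.Icc 0 1) (spectrum ℂ b)ᶜ) {f : ℂ → ℂ}
    (hf : ContinuousOn (fun t => f (p t)) (Set.Icc 0 1)) :
    ∫ t in (0 : ℝ)..1, deriv p t • f (p t) • resolvent b (p t) ∈ smoothSubalgebra S π := by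
  set q : ℝ → ℂ := derivWithin p (Set.Icc 0 1)
  have hq : ContinuousOn q (Set.Icc 0 1) :=
    hp.continuousOn_derivWithin (uniqueDiffOn_Icc zero_lt_one) le_rfl
  -- The values of `deriv p` at the end points are arbitrary, but do not affect the integral.
  have hpq : ∫ t in (0 : ℝ)..1, deriv p t • f (p t) • resolvent b (p t) =
      ∫ t in (0 : ℝ)..1, q t • f (p t) • resolvent b (p t) := by
    refine intervalIntegral.integral_congr_Ioo_of_le zero_le_one fun t ht => ?_
    simp only [q, derivWithin_of_mem_nhds (Icc_mem_nhds ht.1 ht.2)]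
  rw [hpq]
  refine integral_mem_smoothSubalgebra ?_ fun k => ?_
  · refine ContinuousOn.intervalIntegrable ?_
    rw [Set.uIcc_of_le zero_le_one]
    exact hq.smul (hf.smul ((continuousOn_resolvent b).comp hp.continuousOn hpb))
  obtain ⟨C, hC⟩ := exists_norm_innerDerivation_pow_resolvent_le hb hp.continuousOn hpb k
  obtain ⟨M, hM⟩ := isCompact_Icc.exists_bound_of_continuousOn hq
  obtain ⟨N, hN⟩ := isCompact_Icc.exists_bound_of_continuousOn hf
  refine ⟨M * (N * C), fun n t ht => ?_⟩
  have hM0 := (norm_nonneg _).trans (hM t ht)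
  have hN0 := (norm_nonneg _).trans (hN t ht)
  rw [map_smul, map_smul, map_smul, map_smul, norm_smul, norm_smul]
  gcongr
  · exact hM t ht
  · exact hN t ht
  · exact hC n t ht

theorem isClosedUnderHolomorphicCalculus_smoothSubalgebra :
    IsClosedUnderHolomorphicCalculus (smoothSubalgebra S π) := by
  rintro b hb f U x ⟨-, -, hf, c, ⟨hc, -, -⟩, rfl⟩
  refine Subalgebra.smul_mem _ (sum_mem fun i _ => zsmul_mem ?_ _) _
  have hmaps : Set.MapsTo (c.path i) (Set.Icc 0 1) (U \ spectrum ℂ b) := fun t ht =>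
    hc (Set.mem_iUnion.2 ⟨i, Set.mem_image_of_mem _ ht⟩)
  exact integral_resolvent_mem_smoothSubalgebra hb (c.contDiffOn i) (fun t ht => (hmaps ht).2)
    (hf.continuousOn.comp (c.contDiffOn i).continuousOn fun t ht => (hmaps ht).1)

end HolomorphicCalculus

/-! ### Rapidly decreasing sequences as elements of the spatial tensor product -/

section Embedding

variable {Γ : Type*} [Group Γ] {S : Finset Γ}
  {A H : Type*} [CStarAlgebra A] [NormedAddCommGroup H] [InnerProductSpace ℂ H]
  [CompleteSpace H] (π : A →⋆ₐ[ℂ] (H →L[ℂ] H))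

theorem SpatialTensor.tmul_of_add (a b : A) (γ : Γ) :
    SpatialTensor.tmul π (a + b) (ReducedGroupCStar.of γ) =
      SpatialTensor.tmul π a (ReducedGroupCStar.of γ) +
        SpatialTensor.tmul π b (ReducedGroupCStar.of γ) :=
  Subtype.ext <| (congr_arg (algTensorRep π Γ) (TensorProduct.add_tmul a b _)).trans (map_add _ _ _)

theorem SpatialTensor.tmul_of_smul (z : ℂ) (a : A) (γ : Γ) :
    SpatialTensor.tmul π (z • a) (ReducedGroupCStar.of γ) =
      z • SpatialTensor.tmul π a (ReducedGroupCStar.of γ) :=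
  Subtype.ext <| (congr_arg (algTensorRep π Γ) (TensorProduct.smul_tmul' z a _)).symm.trans
    (map_smul _ _ _)

theorem HInfty.summable_tmul (hpoly : HasPolynomialGrowth S) (a : HInfty S A) :
    Summable fun γ : Γ => SpatialTensor.tmul π ((a : Γ → A) γ) (ReducedGroupCStar.of γ) :=
  Summable.of_norm_bounded (by simpa using HInfty.summable_norm_mul_pow hpoly a 0)
    fun γ => SpatialTensor.norm_tmul_of_le π _ γ

/-- The sum `∑ a_γ ⊗ γ` in the spatial tensor product, for a rapidly decreasing sequence `a`. -/
noncomputable def HInfty.toSpatialTensor (hpoly : HasPolynomialGrowth S) :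
    HInfty S A →ₗ[ℂ] SpatialTensor π Γ where
  toFun a := ∑' γ : Γ, SpatialTensor.tmul π ((a : Γ → A) γ) (ReducedGroupCStar.of γ)
  map_add' a b := by
    rw [← (HInfty.summable_tmul π hpoly a).tsum_add (HInfty.summable_tmul π hpoly b)]
    exact tsum_congr fun γ => SpatialTensor.tmul_of_add π _ _ γ
  map_smul' z a := by
    rw [RingHom.id_apply, ← (HInfty.summable_tmul π hpoly a).tsum_const_smul]
    exact tsum_congr fun γ => SpatialTensor.tmul_of_smul π z _ γ

theorem HInfty.hasSum_toSpatialTensor (hpoly : HasPolynomialGrowth S) (a : HInfty S A) :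
    HasSum (fun γ : Γ => SpatialTensor.tmul π ((a : Γ → A) γ) (ReducedGroupCStar.of γ))
      (HInfty.toSpatialTensor π hpoly a) :=
  (HInfty.summable_tmul π hpoly a).hasSum

theorem HInfty.matrixEntry_toSpatialTensor (hpoly : HasPolynomialGrowth S) (a : HInfty S A)
    (γ : Γ) : matrixEntry γ 1 (HInfty.toSpatialTensor π hpoly a : TensorOp H Γ) =
      π ((a : Γ → A) γ) := by
  classical
  have h := (HInfty.hasSum_toSpatialTensor π hpoly a).mapL
    (matrixEntry γ 1 ∘L SpatialTensor.inclusion Γ π)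
  refine h.unique ?_
  have h' : ∀ ρ, ρ ≠ γ → (matrixEntry γ 1 ∘L SpatialTensor.inclusion Γ π)
      (SpatialTensor.tmul π ((a : Γ → A) ρ) (ReducedGroupCStar.of ρ)) = 0 := fun ρ hρ =>
    (SpatialTensor.matrixEntry_tmul_of π _ ρ γ).trans (if_neg hρ)
  convert hasSum_single γ h' using 1
  exact ((SpatialTensor.matrixEntry_tmul_of π _ γ γ).trans (if_pos rfl)).symm

theorem HInfty.toSpatialTensor_injective (hπ : Function.Injective π)
    (hpoly : HasPolynomialGrowth S) :
    Function.Injective (HInfty.toSpatialTensor (S := S) π hpoly) := fun a b hab =>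
  Subtype.ext <| funext fun γ => hπ <| by
    rw [← HInfty.matrixEntry_toSpatialTensor π hpoly, hab, HInfty.matrixEntry_toSpatialTensor]

theorem HInfty.toSpatialTensor_mem (hgen : Subgroup.closure (S : Set Γ) = ⊤)
    (hinv : ∀ γ ∈ S, γ⁻¹ ∈ S) (hpoly : HasPolynomialGrowth S) (a : HInfty S A) :
    HInfty.toSpatialTensor π hpoly a ∈ smoothSubalgebra S π := by
  refine mem_smoothSubalgebra_iff.2 fun k =>
    ⟨∑' γ, ‖(a : Γ → A) γ‖ * (wordLength S γ : ℝ) ^ k, fun n => ?_⟩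
  have h := (HInfty.hasSum_toSpatialTensor π hpoly a).mapL
    ((innerDerivation (lengthOp S H n) ^ k) ∘L SpatialTensor.inclusion Γ π)
  exact h.norm_le_of_bounded (HInfty.summable_norm_mul_pow hpoly a k).hasSum fun γ =>
    norm_innerDerivation_pow_tmul_of_le hgen hinv _ γ k n

theorem HInfty.exists_toSpatialTensor_eq (hπ : Function.Injective π)
    (hpoly : HasPolynomialGrowth S) {b : SpatialTensor π Γ} (hb : b ∈ smoothSubalgebra S π) :
    ∃ a : HInfty S A, HInfty.toSpatialTensor π hpoly a = b := by
  choose a ha using fun γ : Γ => SpatialTensor.matrixEntry_mem_range π hπ b.2 γ 1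
  have hmem : a ∈ HInfty S A := by
    refine mem_HInfty_of_bounded hpoly fun k => ?_
    obtain ⟨C, hC⟩ := bounded_matrixEntry_of_mem_smoothSubalgebra hb k
    refine ⟨C, fun γ => ?_⟩
    rw [← NonUnitalStarAlgHom.norm_map π hπ, ha]
    exact hC γ
  refine ⟨⟨a, hmem⟩, SpatialTensor.ext_matrixEntry π fun γ => ?_⟩
  rw [HInfty.matrixEntry_toSpatialTensor, ← ha]

/-- Rapidly decreasing sequences are the same as smooth elements of the spatial tensor product. -/
noncomputable def HInfty.equivSmoothSubalgebra (hgen : Subgroup.closure (S : Set Γ) = ⊤)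
    (hinv : ∀ γ ∈ S, γ⁻¹ ∈ S) (hpoly : HasPolynomialGrowth S) (hπ : Function.Injective π) :
    HInfty S A ≃ₗ[ℂ] smoothSubalgebra S π :=
  LinearEquiv.ofBijective
    ((HInfty.toSpatialTensor π hpoly).codRestrict (Subalgebra.toSubmodule (smoothSubalgebra S π))
      (HInfty.toSpatialTensor_mem π hgen hinv hpoly))
    ⟨fun _ _ hab => HInfty.toSpatialTensor_injective π hπ hpoly (congr_arg Subtype.val hab),
      fun b => (HInfty.exists_toSpatialTensor_eq π hπ hpoly b.2).imp fun _ ha => Subtype.ext ha⟩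

/-- If `c` is the sequence of coefficients of the product of `∑ a_γ ⊗ γ` and `∑ b_γ ⊗ γ`, then `c`
is the convolution of `a` and `b`. -/
theorem HInfty.hasSum_convolution (hπ : Function.Injective π) (hpoly : HasPolynomialGrowth S)
    {a b c : HInfty S A} (hc : HInfty.toSpatialTensor π hpoly c =
      HInfty.toSpatialTensor π hpoly a * HInfty.toSpatialTensor π hpoly b) (γ : Γ) :
    HasSum (fun ρ : Γ => (a : Γ → A) ρ * (b : Γ → A) (ρ⁻¹ * γ)) ((c : Γ → A) γ) := by
  have hiso : Isometry π := AddMonoidHomClass.isometry_of_norm π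
    (NonUnitalStarAlgHom.norm_map π hπ)
  rw [← hiso.isEmbedding.isInducing.hasSum_iff, ← HInfty.matrixEntry_toSpatialTensor π hpoly, hc]
  have h := ((HInfty.hasSum_toSpatialTensor π hpoly a).mul_right
    (HInfty.toSpatialTensor π hpoly b)).mapL (matrixEntry γ 1 ∘L SpatialTensor.inclusion Γ π)
  have hterm : (π ∘ fun ρ : Γ => (a : Γ → A) ρ * (b : Γ → A) (ρ⁻¹ * γ)) = fun ρ =>
      (matrixEntry γ 1 ∘L SpatialTensor.inclusion Γ π)
        (SpatialTensor.tmul π ((a : Γ → A) ρ) (ReducedGroupCStar.of ρ) *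
          HInfty.toSpatialTensor π hpoly b) := by
    funext ρ
    rw [ContinuousLinearMap.comp_apply, Function.comp_apply, map_mul,
      ← HInfty.matrixEntry_toSpatialTensor π hpoly b, ← matrixEntry_opTensor_mul,
      ← SpatialTensor.coe_tmul_of]
    rfl
  rw [hterm]
  exact h

end Embedding

theorem mainTheorem4 {Γ : Type*} [Group Γ] (S : Finset Γ)
    (hgen : Subgroup.closure (S : Set Γ) = ⊤) (hone : (1 : Γ) ∉ S) (hinv : ∀ γ ∈ S, γ⁻¹ ∈ S)
    (hpoly : HasPolynomialGrowth S)
    {A : Type*} [CStarAlgebra A]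
    {H : Type*} [NormedAddCommGroup H] [InnerProductSpace ℂ H] [CompleteSpace H]
    (π : A →⋆ₐ[ℂ] (H →L[ℂ] H)) (hπ : Function.Injective π) :
    ∃ (T : Subalgebra ℂ (SpatialTensor π Γ)) (ι : HInfty S A ≃ₗ[ℂ] T),
      -- `ι` is the inclusion: it sends a sequence to its sum in `A ⊗ C*_r(Γ)`
      (∀ a : HInfty S A,
        HasSum (fun γ : Γ => SpatialTensor.tmul π ((a : Γ → A) γ) (ReducedGroupCStar.of γ))
          (ι a : SpatialTensor π Γ)) ∧
      -- the product of `T` is the convolution of sequences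
      (∀ (a b : HInfty S A) (γ : Γ),
        HasSum (fun ρ : Γ => (a : Γ → A) ρ * (b : Γ → A) (ρ⁻¹ * γ))
          ((ι.symm (ι a * ι b) : Γ → A) γ)) ∧
      Dense (T : Set (SpatialTensor π Γ)) ∧
      IsSpectralSubalgebra T ∧
      IsClosedUnderHolomorphicCalculus T := by
  refine ⟨smoothSubalgebra S π, HInfty.equivSmoothSubalgebra π hgen hinv hpoly hπ,
    HInfty.hasSum_toSpatialTensor π hpoly, fun a b γ => ?_, dense_smoothSubalgebra hgen hinv,
    isSpectralSubalgebra_smoothSubalgebra, isClosedUnderHolomorphicCalculus_smoothSubalgebra⟩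
  refine HInfty.hasSum_convolution π hπ hpoly ?_ γ
  exact congr_arg Subtype.val ((HInfty.equivSmoothSubalgebra π hgen hinv hpoly hπ).apply_symm_apply
    (HInfty.equivSmoothSubalgebra π hgen hinv hpoly hπ a *
      HInfty.equivSmoothSubalgebra π hgen hinv hpoly hπ b))
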